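/- Let $k\ge 0$. In the full-information model of the $k$-removal prophet problem there is an online algorithm with competitive ratio at least $1/(k+2)$, and it needs only one sample from each distribution. Precisely: let $n\ge k+1$ and let $X_1,\dots,X_n$ be independent nonnegative random variables with distributions $F_1,\dots,F_n$; write $X_{(1)}\ge\dots\ge X_{(n)}$ for their order statistics. Nature removes $k$ variables with the $k$ largest realizations, ties being broken uniformly at random; let $D$ be the set of the $n-k$ remaining indices. The gambler observes the pairs $(i,X_i)$, $i\in D$, one at a time, in an arbitrary fixed order of the indices, without knowing $D$ in advance, and may accept one value irrevocably on arrival; $\mathrm{ALG}$ denotes the accepted value ($0$ if none is accepted). Consider the following randomized algorithm, which knows $k$ and $n$ but not the distributions. It draws samples $s_j\sim F_j$, $j=1,\dots,n$, independent of each other and of everything else, and, independently, an index $I\in\{1,\dots,k+1\}$ with $\mathbb P(I=i)=\frac1{k+2}$ for $i\le k$ and $\mathbb P(I=k+1)=\frac2{k+2}$. Let $\tau=s_{j^*}$ be the $I$-th largest sample. * If $I\le k$, it plays $\overline{MSA}_I$: accept the first observed value that is higher than $\tau$ and whose index is not $j^*$. * If $I=k+1$, it plays $MSA_{k+1}$: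 accept the first observed value that is higher than $\tau$. Ties among samples, and between the threshold and an observed value, are broken at random: the gambler attaches independent uniform $[0,1]$ labels to all samples and all observed values (independent of Nature's choices) and compares equal numbers by their labels. Then, for all such $n$, $X_1,\dots,X_n$ and every arrival order, $$\mathbb E(\mathrm{ALG})\ \ge\ \frac{1}{k+2}\,\mathbb E\big(X_{(k+1)}\big),$$ where the expectations may be infinite. -/

import Mathlib

open MeasureTheory ProbabilityTheory
open scoped NNReal ENNReal

universe u

noncomputable section

namespace RPI

/-! ### Order statistics and random tie-breaking -/

/-- The `(k+1)`-th largest entry of `x` (entries counted with multiplicity), where the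
0-based position `k` is given as an element of `Fin n`; so `k = 0` gives the maximum. -/
def kthLargest {n : ℕ} (x : Fin n → ℝ≥0) (k : Fin n) : ℝ≥0 :=
  x (Tuple.sort x k.rev)

/-- The sort key of entry `j`: first the value `x j`, then the tie-breaking label `u j`.
The labels are drawn i.i.d. uniformly from `[0,1]`, so equal values are put in uniformly random
order; the index itself only serves to make the keys distinct on the null event that two
labels coincide. -/
def tieKey {n : ℕ} (x : Fin n → ℝ≥0) (u : Fin n → unitInterval) (j : Fin n) :
    ℝ≥0 ×ₗ (unitInterval ×ₗ Fin n) :=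
  toLex (x j, toLex (u j, j))

/-- The rank of entry `j` in the decreasing order of `x` with ties broken by `u`;
the largest entry has rank `1`, the smallest has rank `n`. -/
def rank {n : ℕ} (x : Fin n → ℝ≥0) (u : Fin n → unitInterval) (j : Fin n) : ℕ :=
  (Finset.univ.filter fun j' => tieKey x u j ≤ tieKey x u j').card

/-- i.i.d. uniform labels. -/
def labelLaw (n : ℕ) : Measure (Fin n → unitInterval) :=
  Measure.pi fun _ => (volume : Measure unitInterval)

instance (n : ℕ) : IsProbabilityMeasure (labelLaw n) := by
  unfold labelLaw; infer_instance

/-! ### The full-information model -/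

/-- What the gambler observes, in order: the pairs `(i, x i)` for the indices `i` that are not
removed, where Nature removes the `k` entries of rank at most `k` (ties broken by `u`), and
`σ t` is the index in position `t` of the arrival order. -/
def arrivals {n : ℕ} (k : ℕ) (σ : Equiv.Perm (Fin n)) (x : Fin n → ℝ≥0)
    (u : Fin n → unitInterval) : List (Fin n × ℝ≥0) :=
  (((List.finRange n).map σ).filter fun i => k < rank x u i).map fun i => (i, x i)

/-- A (randomized) online algorithm in the full-information model which does not know the
distributions but has one sample from each of them: the decision to accept the current pair
depends on the private random seed, on the samples, on the pairs observed before and on the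
current pair, and on nothing else. -/
structure SampleAlgorithm (n : ℕ) where
  /-- the private random seed, independent of everything else -/
  Seed : Type
  [seedMeasurable : MeasurableSpace Seed]
  /-- the law of the seed -/
  seedLaw : Measure Seed
  [seedProb : IsProbabilityMeasure seedLaw]
  /-- `accept seed samples past current` -/
  accept : Seed → (Fin n → ℝ≥0) → List (Fin n × ℝ≥0) → Fin n × ℝ≥0 → Prop

attribute [instance] SampleAlgorithm.seedMeasurable SampleAlgorithm.seedProb

open Classical in
/-- The value obtained when the stopping rule `accept` is run on a list of arriving pairs, after
the pairs `past` have been rejected: the value of the first accepted pair, and `0` if no pair is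
accepted. -/
def play {n : ℕ} (accept : List (Fin n × ℝ≥0) → Fin n × ℝ≥0 → Prop) :
    List (Fin n × ℝ≥0) → List (Fin n × ℝ≥0) → ℝ≥0
  | _, [] => 0
  | past, a :: future =>
      if accept past a then a.2 else play accept (past ++ [a]) future

/-- The expected value `E(ALG)` accepted by the algorithm `A` on the instance `X`, when the `k`
largest values are removed and the arrival order is `σ`. The four independent sources of
randomness are: the values `X i`, Nature's tie-breaking labels, the samples (the `j`-th with the
law of `X j`, independent of each other), and the seed of the algorithm. -/
def expectedReward {n : ℕ} (A : SampleAlgorithm n) (k : ℕ) (σ : Equiv.Perm (Fin n))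
    {Ω : Type*} [MeasurableSpace Ω] (P : Measure Ω) (X : Fin n → Ω → ℝ≥0) : ℝ≥0∞ :=
  ∫⁻ ω : Ω × (Fin n → unitInterval) × (Fin n → ℝ≥0) × A.Seed,
      (play (A.accept ω.2.2.2 ω.2.2.1) []
        (arrivals k σ (fun i => X i ω.1) ω.2.1) : ℝ≥0∞)
    ∂(P.prod ((labelLaw n).prod ((Measure.pi fun j => P.map (X j)).prod A.seedLaw)))

/-- The family `A` (one algorithm for each number `n` of variables) has competitive ratio at
least `γ` for the problem with `k` removals: `E(ALG) ≥ γ · E(X_(k+1))` for every sequence of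
`n ≥ k + 1` independent nonnegative random variables and every arrival order. -/
def HasCompetitiveRatio (k : ℕ) (A : (n : ℕ) → SampleAlgorithm n) (γ : ℝ≥0) : Prop :=
  ∀ (n : ℕ) (hn : k < n) (Ω : Type u) [MeasurableSpace Ω] (P : Measure Ω)
    [IsProbabilityMeasure P] (X : Fin n → Ω → ℝ≥0),
    (∀ i, Measurable (X i)) → iIndepFun X P → ∀ σ : Equiv.Perm (Fin n),
      (γ : ℝ≥0∞) * ∫⁻ ω, (kthLargest (fun i => X i ω) ⟨k, hn⟩ : ℝ≥0∞) ∂P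
        ≤ expectedReward (A n) k σ P X

/-! ### The algorithms -/

/-- The labels with which the gambler breaks ties: one for each arriving value (first component)
and one for each sample (second component). -/
abbrev TieLabels (n : ℕ) : Type := (Fin n → unitInterval) × (Fin n → unitInterval)

/-- The threshold rule with threshold `τ = s j`, where `j` is the index of the `i`-th largest
sample: accept the current value if it is higher than `τ`, ties broken by the labels. -/
def msaRule {n : ℕ} (i : ℕ) (v : TieLabels n) (s : Fin n → ℝ≥0) (a : Fin n × ℝ≥0) : Prop :=
  ∃ j, rank s v.2 j = i ∧ toLex (s j, v.2 j) < toLex (a.2, v.1 a.1)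

/-- The same rule, except that a value which comes from the same distribution as the threshold
is never accepted. -/
def msaBarRule {n : ℕ} (i : ℕ) (v : TieLabels n) (s : Fin n → ℝ≥0) (a : Fin n × ℝ≥0) : Prop :=
  ∃ j, rank s v.2 j = i ∧ toLex (s j, v.2 j) < toLex (a.2, v.1 a.1) ∧ a.1 ≠ j

/-- The law of the index of the algorithm to be played; the element `i` of `Fin (k + 1)` stands
for the algorithm number `i + 1`. Each of the numbers `1, …, k` has probability `1/(k+2)`, and
`k + 1` has probability `2/(k+2)`. -/
def choiceLaw (k : ℕ) : Measure (Fin (k + 1)) :=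
  ∑ i : Fin (k + 1), (if (i : ℕ) < k then 1 / ((k : ℝ≥0∞) + 2) else 2 / ((k : ℝ≥0∞) + 2)) •
    Measure.dirac i

instance (k : ℕ) : IsProbabilityMeasure (choiceLaw k) := by
  constructor
  have h : (k : ℝ≥0∞) + 2 ≠ 0 := by simp
  have h' : (k : ℝ≥0∞) + 2 ≠ ∞ := by finiteness
  rw [choiceLaw, Measure.coe_finsetSum, Finset.sum_apply, Fin.sum_univ_castSucc]
  simp only [Measure.smul_apply, measure_univ, smul_eq_mul, mul_one, Fin.val_castSucc, Fin.is_lt,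
    if_true, Fin.val_last, lt_irrefl, if_false, Finset.sum_const, Finset.card_univ,
    Fintype.card_fin, nsmul_eq_mul]
  rw [mul_one_div, ← ENNReal.add_div, ENNReal.div_self h h']

/-- The randomized algorithm: play the rule `msaBarRule i` with probability `1/(k+2)` for each
`i = 1, …, k`, and `msaRule (k+1)` with probability `2/(k+2)`. -/
def msaRand (k n : ℕ) : SampleAlgorithm n where
  Seed := Fin (k + 1) × TieLabels n
  seedLaw := (choiceLaw k).prod ((labelLaw n).prod (labelLaw n))
  accept seed s _ a :=
    if (seed.1 : ℕ) < k then msaBarRule (seed.1 + 1) seed.2 s a else msaRule (k + 1) seed.2 s a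

end RPI

end

/-! Fix a level `t`. Suppose that the threshold is the sample at index `j`, that more than `k`
values are candidates above it (index `j` excluded for the barred rules), and that all candidates
exceed `t`. Then the reward exceeds `t` whatever Nature removes: only candidates are accepted, and
at least one survives. `guarantee` turns this into a pathwise lower bound (`sum_guarantee_le_play`).

It remains to bound the probability that more than `k` values exceed `t` by the success
probabilities of the rules. The value and the sample at an index are exchangeable, so swapping all
pairs, or one pair, preserves the law. The combinatorial core `exists_succeeds` says that some rule
succeeds in the configuration itself, after swapping everything, or after swapping only the pair at
the index of the new threshold.

In the union bound each barred rule is charged once, through the single swap. Rule `k + 1` is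
charged once without a swap. Its full-swap case lands where more than `k` samples exceed `t` and its
single-swap case in the complement, so these two together cost one more charge. The weights 1, ...,
1, 2 are `k + 2` times the probabilities of the random choice (`measure_lt_card_le`), and
integrating over `t` gives the theorem. -/

namespace RPI

/-! ### Ranks in a decreasing order -/

section Ranks

variable {ι K : Type*} [Fintype ι] [LinearOrder K]

/-- The position of `f j` when the entries of `f` are listed in decreasing order. -/
def decRank (f : ι → K) (j : ι) : ℕ :=
  (Finset.univ.filter fun j' => f j ≤ f j').card

theorem decRank_eq_card_lt_add_one {f : ι → K} (hf : Function.Injective f) (j : ι) :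
    decRank f j = (Finset.univ.filter fun j' => f j < f j').card + 1 := by
  classical
  have h : (Finset.univ.filter fun j' => f j ≤ f j')
      = insert j (Finset.univ.filter fun j' => f j < f j') := by
    ext j'
    simp only [Finset.mem_filter, Finset.mem_univ, true_and, Finset.mem_insert, le_iff_lt_or_eq,
      hf.eq_iff]
    tauto
  rw [decRank, h, Finset.card_insert_of_notMem (by simp)]

theorem decRank_lt_of_lt {f : ι → K} {i j : ι} (h : f i < f j) : decRank f j < decRank f i := by
  refine Finset.card_lt_card ⟨fun j' hj' => ?_, fun hs => ?_⟩
  · simp only [Finset.mem_filter, Finset.mem_univ, true_and] at hj' ⊢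
    exact h.le.trans hj'
  · have := hs (show i ∈ Finset.univ.filter fun j' => f i ≤ f j' by simp)
    simp only [Finset.mem_filter, Finset.mem_univ, true_and] at this
    exact absurd h this.not_gt

theorem decRank_injective {f : ι → K} (hf : Function.Injective f) :
    Function.Injective (decRank f) := by
  intro i j hij
  by_contra hne
  rcases lt_or_gt_of_ne (hf.ne hne) with h | h
  · exact absurd hij (decRank_lt_of_lt h).ne'
  · exact absurd hij (decRank_lt_of_lt h).ne

theorem one_le_decRank (f : ι → K) (j : ι) : 1 ≤ decRank f j :=
  Finset.card_pos.2 ⟨j, by simp⟩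

theorem exists_decRank_eq {f : ι → K} (hf : Function.Injective f) {m : ℕ} (h1 : 1 ≤ m)
    (hm : m ≤ Fintype.card ι) : ∃ j, decRank f j = m := by
  have himage : Finset.univ.image (decRank f) = Finset.Icc 1 (Fintype.card ι) := by
    refine Finset.eq_of_subset_of_card_le ?_ ?_
    · intro r hr
      obtain ⟨j, -, rfl⟩ := Finset.mem_image.1 hr
      exact Finset.mem_Icc.2 ⟨one_le_decRank f j, Finset.card_le_univ _⟩
    · rw [Finset.card_image_of_injective _ (decRank_injective hf)]
      simp
  have : m ∈ Finset.univ.image (decRank f) := by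
    rw [himage]
    exact Finset.mem_Icc.2 ⟨h1, hm⟩
  obtain ⟨j, -, hj⟩ := Finset.mem_image.1 this
  exact ⟨j, hj⟩

theorem card_decRank_le {f : ι → K} (hf : Function.Injective f) (k : ℕ) :
    (Finset.univ.filter fun j => decRank f j ≤ k).card ≤ k := by
  calc (Finset.univ.filter fun j => decRank f j ≤ k).card
      ≤ (Finset.Icc 1 k).card := by
        refine Finset.card_le_card_of_injOn (decRank f) (fun j hj => ?_)
          (decRank_injective hf).injOn
        have : decRank f j ≤ k := by simpa using hj
        simpa using ⟨one_le_decRank f j, this⟩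
    _ = k := by simp

end Ranks

/-! ### The deterministic covering by swapped configurations -/

section Cover

variable {ι K : Type*} [Fintype ι] [DecidableEq ι] [LinearOrder K]

/-- The indices of the observed keys `a` above the threshold `c j`, where the index `j` itself is
left out if `i < k`. -/
def candidates (k i : ℕ) (a c : ι → K) (j : ι) : Finset ι :=
  Finset.univ.filter fun j' => (i < k → j' ≠ j) ∧ c j < a j'

theorem mem_candidates {k i : ℕ} {a c : ι → K} {j j' : ι} :
    j' ∈ candidates k i a c j ↔ (i < k → j' ≠ j) ∧ c j < a j' := by
  simp [candidates]

/-- The threshold `c j` is the `(i+1)`-th largest sample, there are more than `k` candidates above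
it, and all of them lie in `U`. -/
def Succeeds (k i : ℕ) (U : Set K) (a c : ι → K) (j : ι) : Prop :=
  decRank c j = i + 1 ∧ (∀ j' ∈ candidates k i a c j, a j' ∈ U) ∧
    k < (candidates k i a c j).card

/-- The case split is on whether the `(k+1)`-th largest sample `c q` lies in `U`, and then on
whether it already works as a threshold. If it is too high, the roles of values and samples are
exchanged; if it is too low, it is replaced by the largest value outside `U`. The cardinality bound
in the third case separates it from the second, where more than `k` samples lie in `U` after the
swap. -/
theorem exists_succeeds {k : ℕ} {U : Set K} [DecidablePred (· ∈ U)] (hU : IsUpperSet U)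
    {a c : ι → K} (ha : Function.Injective a) (hc : Function.Injective c)
    (hac : ∀ i j, a i ≠ c j) (hA : k < (Finset.univ.filter fun j => a j ∈ U).card) :
    (∃ j, Succeeds k k U a c j) ∨
    (∃ j, Succeeds k k U c a j) ∨
    (∃ j, Succeeds k k U (Function.update a j (c j)) (Function.update c j (a j)) j ∧
      (Finset.univ.filter fun j' => Function.update c j (a j) j' ∈ U).card ≤ k) ∨
    (∃ i < k, ∃ j, Succeeds k i U (Function.update a j (c j)) (Function.update c j (a j)) j) := by
  have hcard : k + 1 ≤ Fintype.card ι := hA.trans_le (Finset.card_le_univ _)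
  obtain ⟨q, hq⟩ := exists_decRank_eq hc (Nat.le_add_left 1 k) hcard
  have hqlt : (Finset.univ.filter fun j' => c q < c j').card = k := by
    have := decRank_eq_card_lt_add_one hc q
    omega
  by_cases hqU : c q ∈ U
  · by_cases hmany : k < (candidates k k a c q).card
    · exact Or.inl ⟨q, hq, fun j' hj' => hU (mem_candidates.1 hj').2.le hqU, hmany⟩
    -- The `(k+1)`-th largest value `a p` is below `c q`, so at least `k + 1` samples are above `a
    -- p`; it lies in `U` because more than `k` values do.
    · obtain ⟨p, hp⟩ := exists_decRank_eq ha (Nat.le_add_left 1 k) hcard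
      have hpq : a p < c q := by
        by_contra hle
        have hlt : c q < a p := lt_of_le_of_ne (not_lt.1 hle) (hac p q).symm
        apply hmany
        calc k < decRank a p := by omega
          _ ≤ _ := Finset.card_le_card fun j' hj' => mem_candidates.2
            ⟨fun h => absurd h (lt_irrefl k), hlt.trans_le (by simpa using hj')⟩
      have hpU : a p ∈ U := by
        by_contra hpU
        have h1 := decRank_eq_card_lt_add_one ha p
        have h2 : (Finset.univ.filter fun j => a j ∈ U).card
            ≤ (Finset.univ.filter fun j' => a p < a j').card := by
          refine Finset.card_le_card fun j' hj' => ?_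
          simp only [Finset.mem_filter, Finset.mem_univ, true_and] at hj' ⊢
          exact lt_of_not_ge fun h => hpU (hU h hj')
        omega
      refine Or.inr (Or.inl ⟨p, hp, fun j' hj' => hU (mem_candidates.1 hj').2.le hpU, ?_⟩)
      calc k < decRank c q := by omega
        _ ≤ _ := Finset.card_le_card fun j' hj' => mem_candidates.2
          ⟨fun h => absurd h (lt_irrefl k), hpq.trans_le (by simpa using hj')⟩
  · have hsU : (Finset.univ.filter fun j' => c j' ∈ U).card ≤ k := by
      refine hqlt ▸ Finset.card_le_card fun j' hj' => ?_
      simp only [Finset.mem_filter, Finset.mem_univ, true_and] at hj' ⊢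
      exact lt_of_not_ge fun h => hqU (hU h hj')
    by_cases hpure : ∀ j', c q < a j' → a j' ∈ U
    · refine Or.inl ⟨q, hq, fun j' hj' => hpure j' (mem_candidates.1 hj').2, hA.trans_le ?_⟩
      refine Finset.card_le_card fun j' hj' => mem_candidates.2
        ⟨fun h => absurd h (lt_irrefl k), ?_⟩
      exact lt_of_not_ge fun h => hqU (hU h (by simpa using hj'))
    · push Not at hpure
      obtain ⟨j₀, hj₀, hj₀U⟩ := hpure
      -- The largest value outside `U` is the ideal threshold: exactly the values in `U` are above
      -- it. Swapping at `j` makes it a sample.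
      obtain ⟨j, hjmem, hjmax⟩ := Finset.exists_max_image
        (Finset.univ.filter fun j => a j ∉ U) a ⟨j₀, by simpa using hj₀U⟩
      have hjU : a j ∉ U := by simpa using hjmem
      have hqj : c q < a j := hj₀.trans_le (hjmax j₀ (by simpa using hj₀U))
      have habove : ∀ j', a j < a j' → a j' ∈ U := fun j' h => by
        by_contra hn
        exact absurd h (hjmax j' (by simpa using hn)).not_gt
      have hsub : ∀ j', a j < c j' → c q < c j' := fun j' h => hqj.trans h
      set a' := Function.update a j (c j) with ha'
      set c' := Function.update c j (a j) with hc'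
      have hc'j : c' j = a j := by simp [hc']
      have ha'j : a' j = c j := by simp [ha']
      have hc'ne : ∀ j', j' ≠ j → c' j' = c j' := fun j' h => by simp [hc', h]
      have ha'ne : ∀ j', j' ≠ j → a' j' = a j' := fun j' h => by simp [ha', h]
      have hrank_subset : (Finset.univ.filter fun j' => c' j ≤ c' j')
          ⊆ insert j (Finset.univ.filter fun j' => a j < c j') := by
        intro j' hj'
        simp only [Finset.mem_filter, Finset.mem_univ, true_and, Finset.mem_insert] at hj' ⊢
        by_cases h : j' = j
        · exact Or.inl h
        · rw [hc'j, hc'ne j' h] at hj'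
          exact Or.inr (lt_of_le_of_ne hj' (hac j j'))
      have habove_card : (Finset.univ.filter fun j' => a j < c j').card ≤ k := by
        refine hqlt ▸ Finset.card_le_card fun j' hj' => ?_
        simp only [Finset.mem_filter, Finset.mem_univ, true_and] at hj' ⊢
        exact hsub j' hj'
      -- Every sample above `a j` is above `c q`, and there are only `k` of those; the extra one is
      -- `j` itself.
      have hrank : decRank c' j ≤ k + 1 :=
        (Finset.card_le_card hrank_subset).trans
          ((Finset.card_insert_le _ _).trans (by omega))
      have hmany : ∀ i, k < (candidates k i a' c' j).card := fun i => by
        refine hA.trans_le (Finset.card_le_card fun j' hj' => mem_candidates.2 ?_)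
        have hj'U : a j' ∈ U := by simpa using hj'
        have hne : j' ≠ j := by
          rintro rfl
          exact hjU hj'U
        refine ⟨fun _ => hne, ?_⟩
        rw [hc'j, ha'ne j' hne]
        exact lt_of_not_ge fun h => hjU (hU h hj'U)
      have hne_mem : ∀ j', j' ≠ j → c' j < a' j' → a' j' ∈ U := fun j' hne h => by
        rw [ha'ne j' hne] at h ⊢
        exact habove j' (hc'j ▸ h)
      obtain ⟨i, hi⟩ : ∃ i, decRank c' j = i + 1 :=
        ⟨decRank c' j - 1, by have := one_le_decRank c' j; omega⟩
      by_cases hik : i < k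
      · exact Or.inr (Or.inr (Or.inr ⟨i, hik, j, hi, fun j' hj' =>
          hne_mem j' ((mem_candidates.1 hj').1 hik) (mem_candidates.1 hj').2, hmany i⟩))
      · obtain rfl : i = k := by omega
        -- The unbarred rule could accept the new value `c j`, which may be outside `U`. But if `c
        -- j` were above `a j`, it would be one of the `k` samples above `c q`, and removing it
        -- would leave rank at most `k` for the new threshold.
        have hjlow : c j < a j := by
          by_contra hn
          have hlt : a j < c j := lt_of_le_of_ne (not_lt.1 hn) (hac j j)
          have : insert j (Finset.univ.filter fun j' => a j < c j')
              = Finset.univ.filter fun j' => a j < c j' :=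
            Finset.insert_eq_of_mem (by simpa using hlt)
          have h2 := Finset.card_le_card hrank_subset
          rw [this] at h2
          have h3 : decRank c' j ≤ i := h2.trans habove_card
          omega
        refine Or.inr (Or.inr (Or.inl ⟨j, ⟨hi, fun j' hj' => ?_, hmany i⟩, ?_⟩))
        · have h : c' j < a' j' := (mem_candidates.1 hj').2
          refine hne_mem j' (fun he => ?_) h
          rw [he, hc'j, ha'j] at h
          exact absurd h hjlow.not_gt
        · refine (Finset.card_le_card fun j' hj' => ?_).trans hsU
          simp only [Finset.mem_filter, Finset.mem_univ, true_and] at hj' ⊢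
          by_cases h : j' = j
          · subst h
            exact absurd (hc'j ▸ hj') hjU
          · exact hc'ne j' h ▸ hj'

end Cover

/-! ### Pathwise lower bound for the reward -/

section Reward

variable {n : ℕ}

theorem le_play (accept : List (Fin n × ℝ≥0) → Fin n × ℝ≥0 → Prop) {m : ℝ≥0}
    (L : List (Fin n × ℝ≥0)) (hm : ∀ past, ∀ a ∈ L, accept past a → m ≤ a.2)
    (hL : ∃ a ∈ L, ∀ past, accept past a) (past : List (Fin n × ℝ≥0)) :
    m ≤ play accept past L := by
  induction L generalizing past with
  | nil => simp at hL
  | cons b L ih =>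
    rw [play]
    split_ifs with hb
    · exact hm past b (by simp) hb
    · refine ih (fun past a ha => hm past a (by simp [ha])) ?_ _
      obtain ⟨a, ha, hacc⟩ := hL
      rcases List.mem_cons.1 ha with rfl | ha
      · exact absurd (hacc past) hb
      · exact ⟨a, ha, hacc⟩

theorem mem_arrivals {k : ℕ} {σ : Equiv.Perm (Fin n)} {x : Fin n → ℝ≥0}
    {u : Fin n → unitInterval} {a : Fin n × ℝ≥0} :
    a ∈ arrivals k σ x u ↔ k < rank x u a.1 ∧ a.2 = x a.1 := by
  obtain ⟨i, y⟩ := a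
  simp only [arrivals, List.mem_map, List.mem_filter, List.mem_finRange, true_and,
    decide_eq_true_eq, Prod.mk.injEq]
  constructor
  · rintro ⟨j, ⟨-, hj⟩, rfl, rfl⟩
    exact ⟨hj, rfl⟩
  · rintro ⟨hi, rfl⟩
    exact ⟨i, ⟨⟨σ.symm i, by simp⟩, hi⟩, rfl, rfl⟩

theorem tieKey_injective (x : Fin n → ℝ≥0) (u : Fin n → unitInterval) :
    Function.Injective (tieKey x u) := by
  intro i j h
  have := congrArg (fun p => (ofLex (ofLex p).2).2) h
  simpa [tieKey] using this

theorem card_rank_le (x : Fin n → ℝ≥0) (u : Fin n → unitInterval) (k : ℕ) :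
    (Finset.univ.filter fun j => rank x u j ≤ k).card ≤ k :=
  card_decRank_le (tieKey_injective x u) k

/-- The index in the sort key matters only when value and label both coincide, which injectivity
rules out. -/
theorem rank_eq_decRank {s : Fin n → ℝ≥0} {v : Fin n → unitInterval}
    (h : Function.Injective fun j => toLex (s j, v j)) (j : Fin n) :
    rank s v j = decRank (fun j => toLex (s j, v j)) j := by
  unfold rank decRank
  congr 1
  ext j'
  simp only [Finset.mem_filter, Finset.mem_univ, true_and]
  by_cases hj : j = j'
  · simp [hj]
  · have hne : ¬ (s j = s j' ∧ v j = v j') := fun hh => hj (h (by simp [hh.1, hh.2]))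
    simp only [tieKey, Prod.Lex.toLex_le_toLex, le_iff_lt_or_eq (a := v j)]
    tauto

/-- The values with their labels, paired with the samples and theirs. -/
abbrev Config (n : ℕ) : Type := Fin n → (ℝ≥0 × unitInterval) × (ℝ≥0 × unitInterval)

/-- The keys by which the gambler compares the values. -/
noncomputable def valueKey (ω : Config n) (j : Fin n) : ℝ≥0 ×ₗ unitInterval := toLex (ω j).1

/-- The keys by which the gambler compares the samples. -/
noncomputable def sampleKey (ω : Config n) (j : Fin n) : ℝ≥0 ×ₗ unitInterval := toLex (ω j).2

/-- The smallest value of `x` on `S`. -/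
noncomputable def lowest (S : Finset (Fin n)) (x : Fin n → ℝ≥0) : ℝ≥0 :=
  if h : S.Nonempty then S.inf' h x else 0

theorem lt_lowest {S : Finset (Fin n)} {x : Fin n → ℝ≥0} {t : ℝ≥0} :
    t < lowest S x ↔ S.Nonempty ∧ ∀ j ∈ S, t < x j := by
  unfold lowest
  split_ifs with h
  · simp [h]
  · simp [h]

theorem lowest_le {S : Finset (Fin n)} {x : Fin n → ℝ≥0} {j : Fin n} (hj : j ∈ S) :
    lowest S x ≤ x j := by
  rw [lowest, dif_pos ⟨j, hj⟩]
  exact Finset.inf'_le _ hj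

/-- A lower bound for the reward of the rule number `i + 1`, whatever `k` values are removed, on
the event that the threshold is the sample `j`. -/
noncomputable def guarantee (k i : ℕ) (ω : Config n) (j : Fin n) : ℝ≥0 :=
  if decRank (sampleKey ω) j = i + 1 ∧
      k < (candidates k i (valueKey ω) (sampleKey ω) j).card then
    lowest (candidates k i (valueKey ω) (sampleKey ω) j) fun j' => (ω j').1.1
  else 0

/-- The keys of the numbers above `t`. -/
def keysAbove (t : ℝ≥0) : Set (ℝ≥0 ×ₗ unitInterval) := {p | t < (ofLex p).1}

theorem isUpperSet_keysAbove (t : ℝ≥0) : IsUpperSet (keysAbove t) := by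
  intro p q hpq hp
  have : (ofLex p).1 ≤ (ofLex q).1 := by
    rcases (Prod.Lex.le_iff).1 hpq with h | h
    · exact h.le
    · exact h.1.le
  exact lt_of_lt_of_le (show t < (ofLex p).1 from hp) this

theorem lt_guarantee_iff {k i : ℕ} {ω : Config n} {j : Fin n} {t : ℝ≥0} :
    t < guarantee k i ω j ↔ Succeeds k i (keysAbove t) (valueKey ω) (sampleKey ω) j := by
  unfold guarantee Succeeds
  split_ifs with h
  · rw [lt_lowest]
    exact ⟨fun h' => ⟨h.1, h'.2, h.2⟩, fun h' => ⟨Finset.card_pos.1 (by omega), h'.2.1⟩⟩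
  · simp only [not_lt_zero, false_iff]
    exact fun h' => h ⟨h'.1, h'.2.2⟩

/-- The configuration made of the values `x`, the samples `s` and the labels `v`. -/
def config (x s : Fin n → ℝ≥0) (v : TieLabels n) : Config n :=
  fun j => ((x j, v.1 j), (s j, v.2 j))

/-- Only the sample of rank `i + 1` contributes to the sum. On observed pairs the rule accepts
exactly the candidates, independently of the past. -/
theorem sum_guarantee_le_play {k : ℕ} (σ : Equiv.Perm (Fin n)) (x s : Fin n → ℝ≥0)
    (u : Fin n → unitInterval) (v : TieLabels n) (i : Fin (k + 1))
    (hs : Function.Injective (sampleKey (config x s v))) :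
    ∑ j, guarantee k i (config x s v) j
      ≤ play ((msaRand k n).accept (i, v) s) [] (arrivals k σ x u) := by
  set ω := config x s v with hω
  have hrank : ∀ j, rank s v.2 j = decRank (sampleKey ω) j := fun j => rank_eq_decRank hs j
  by_cases hex : ∃ j, decRank (sampleKey ω) j = i + 1 ∧
      k < (candidates k i (valueKey ω) (sampleKey ω) j).card
  · obtain ⟨j, hj, hcard⟩ := hex
    have huniq : ∀ j', rank s v.2 j' = i + 1 → j' = j := fun j' h =>
      decRank_injective hs (by rw [← hrank, h, hj])
    have hacc : ∀ past a, (msaRand k n).accept (i, v) s past a ↔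
        ((i : ℕ) < k → a.1 ≠ j) ∧ toLex (s j, v.2 j) < toLex (a.2, v.1 a.1) := by
      intro past a
      change (if (i : ℕ) < k then msaBarRule (i + 1) v s a else msaRule (k + 1) v s a) ↔ _
      split_ifs with hik
      · constructor
        · rintro ⟨j', h1, h2, h3⟩
          obtain rfl := huniq j' h1
          exact ⟨fun _ => h3, h2⟩
        · exact fun h => ⟨j, by rw [hrank, hj], h.2, h.1 hik⟩
      · have hik' : (i : ℕ) = k := by omega
        constructor
        · rintro ⟨j', h1, h2⟩
          obtain rfl := huniq j' (by rw [h1, hik'])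
          exact ⟨fun h => absurd h hik, h2⟩
        · exact fun h => ⟨j, by rw [hrank, hj, hik'], h.2⟩
    have hacc' : ∀ past a, a ∈ arrivals k σ x u → ((msaRand k n).accept (i, v) s past a ↔
        a.1 ∈ candidates k i (valueKey ω) (sampleKey ω) j) := by
      intro past a ha
      rw [hacc, mem_candidates, (mem_arrivals.1 ha).2]
      rfl
    rw [Finset.sum_eq_single j]
    · rw [guarantee, if_pos ⟨hj, hcard⟩]
      refine le_play _ _ (fun past a ha h => ?_) ?_ _
      · rw [(mem_arrivals.1 ha).2]
        exact lowest_le ((hacc' past a ha).1 h)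
      -- Pigeonhole: at most `k` indices are removed and there are more than `k` candidates.
      · obtain ⟨p, hp, hpk⟩ : ∃ p ∈ candidates k i (valueKey ω) (sampleKey ω) j,
            k < rank x u p := by
          by_contra! hno
          have := (Finset.card_le_card fun p hp =>
            Finset.mem_filter.2 ⟨Finset.mem_univ p, hno p hp⟩).trans (card_rank_le x u k)
          omega
        have hmem : (p, x p) ∈ arrivals k σ x u := mem_arrivals.2 ⟨hpk, rfl⟩
        exact ⟨(p, x p), hmem, fun past => (hacc' past _ hmem).2 hp⟩
    · intro j' _ hne
      rw [guarantee, if_neg]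
      rintro ⟨h, -⟩
      exact hne (huniq j' (by rw [hrank, h]))
    · simp
  · push Not at hex
    rw [Finset.sum_eq_zero]
    · exact zero_le
    · intro j _
      rw [guarantee, if_neg]
      rintro ⟨h1, h2⟩
      exact absurd h2 (hex j h1).not_gt

theorem lt_kthLargest_iff (x : Fin n → ℝ≥0) {k : ℕ} (hk : k < n) (t : ℝ≥0) :
    t < kthLargest x ⟨k, hk⟩ ↔ k < (Finset.univ.filter fun j => t < x j).card := by
  have hmono := Tuple.monotone_sort x
  have hcard : (Finset.univ.filter fun j => t < x j).card
      = (Finset.univ.filter fun j => t < x (Tuple.sort x j)).card := by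
    refine (Finset.card_bij (fun j _ => Tuple.sort x j) ?_ ?_ ?_).symm
    · simp
    · intro a _ b _ h
      exact (Tuple.sort x).injective h
    · intro b hb
      exact ⟨(Tuple.sort x).symm b, by simpa using hb, by simp⟩
  rw [hcard, kthLargest]
  set r : Fin n := Fin.rev ⟨k, hk⟩ with hr
  have hrv : (r : ℕ) = n - (k + 1) := by simp [hr, Fin.val_rev]
  constructor
  · intro h
    calc k < (Finset.Ici r).card := by rw [Fin.card_Ici]; omega
      _ ≤ _ := Finset.card_le_card fun j hj => by
        simp only [Finset.mem_filter, Finset.mem_univ, true_and]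
        exact h.trans_le (hmono (Finset.mem_Ici.1 hj))
  · intro h
    by_contra hn
    have : (Finset.univ.filter fun j => t < x (Tuple.sort x j)).card ≤ (Finset.Ioi r).card :=
      Finset.card_le_card fun j hj => by
        simp only [Finset.mem_filter, Finset.mem_univ, true_and] at hj
        refine Finset.mem_Ioi.2 (lt_of_not_ge fun hle => hn ?_)
        exact hj.trans_le (hmono hle)
    rw [Fin.card_Ioi] at this
    omega

end Reward

/-! ### Exchangeability, the union bound and integration over levels -/

section Probability

variable {n : ℕ}

/-- The law of the configuration when the `j`-th value and the `j`-th sample have law `F j`. -/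
noncomputable def configLaw (F : Fin n → Measure ℝ≥0) : Measure (Config n) :=
  Measure.pi fun j => ((F j).prod volume).prod ((F j).prod volume)

/-- Exchange all the values with the samples. -/
def swapAll (ω : Config n) : Config n := fun j => (ω j).swap

/-- Exchange the value with the sample at the index `j`. -/
def swapAt (j : Fin n) (ω : Config n) : Config n :=
  fun j' => (if j' = j then Prod.swap else id) (ω j')

theorem valueKey_swapAt (j : Fin n) (ω : Config n) :
    valueKey (swapAt j ω) = Function.update (valueKey ω) j (sampleKey ω j) := by
  ext1 j'
  by_cases h : j' = j
  · subst h; simp [valueKey, sampleKey, swapAt]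
  · simp [valueKey, swapAt, h]

theorem sampleKey_swapAt (j : Fin n) (ω : Config n) :
    sampleKey (swapAt j ω) = Function.update (sampleKey ω) j (valueKey ω j) := by
  ext1 j'
  by_cases h : j' = j
  · subst h; simp [valueKey, sampleKey, swapAt]
  · simp [sampleKey, swapAt, h]

theorem measurePreserving_swapAll (F : Fin n → Measure ℝ≥0) [∀ j, IsProbabilityMeasure (F j)] :
    MeasurePreserving swapAll (configLaw F) (configLaw F) :=
  measurePreserving_pi _ _ fun _ => Measure.measurePreserving_swap

theorem measurePreserving_swapAt (F : Fin n → Measure ℝ≥0) [∀ j, IsProbabilityMeasure (F j)]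
    (j : Fin n) : MeasurePreserving (swapAt j) (configLaw F) (configLaw F) := by
  refine measurePreserving_pi (f := fun j' => if j' = j then Prod.swap else id) _ _ fun j' => ?_
  by_cases h : j' = j
  · simp only [h, if_true]
    exact Measure.measurePreserving_swap
  · simp only [h, if_false]
    exact MeasurePreserving.id _

instance (F : Fin n → Measure ℝ≥0) [∀ j, IsProbabilityMeasure (F j)] :
    IsProbabilityMeasure (configLaw F) := by
  unfold configLaw; infer_instance

theorem ae_prod_ne {α β γ : Type*} [MeasurableSpace α] [MeasurableSpace β] [MeasurableSpace γ]
    [MeasurableEq γ] (μ : Measure α) (ν : Measure β) [SFinite ν]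
    {f : α → γ} {g : β → γ} (hf : Measurable f) (hg : Measurable g)
    (h : ∀ c, ν {y | g y = c} = 0) : ∀ᵐ p ∂μ.prod ν, f p.1 ≠ g p.2 := by
  have hm : MeasurableSet {p : α × β | f p.1 = g p.2} :=
    measurableSet_eq_fun (hf.comp measurable_fst) (hg.comp measurable_snd)
  rw [ae_iff]
  simp only [not_not]
  rw [Measure.measure_prod_null hm]
  refine Filter.Eventually.of_forall fun x => ?_
  have : Prod.mk x ⁻¹' {p : α × β | f p.1 = g p.2} = {y | g y = f x} := by
    ext y; simp [eq_comm]
  simpa [this] using h (f x)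

theorem prod_volume_label_eq (μ : Measure ℝ≥0) [IsProbabilityMeasure μ] (c : unitInterval) :
    (μ.prod (volume : Measure unitInterval)) {y | y.2 = c} = 0 := by
  have : {y : ℝ≥0 × unitInterval | y.2 = c} = Set.univ ×ˢ {c} := by ext; simp
  rw [this, Measure.prod_prod]
  simp

theorem ae_pi_ne {α : Type*} [MeasurableSpace α] (μ : Fin n → Measure α)
    [∀ j, IsProbabilityMeasure (μ j)] {f g : α → unitInterval} (hf : Measurable f)
    (hg : Measurable g) {i j : Fin n} (hij : i ≠ j) (h : ∀ c, μ j {y | g y = c} = 0) :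
    ∀ᵐ ω ∂Measure.pi μ, f (ω i) ≠ g (ω j) := by
  have hind : IndepFun (fun ω : Fin n → α => ω i) (fun ω => ω j) (Measure.pi μ) :=
    (iIndepFun_pi (μ := μ) (X := fun _ => id) fun _ => aemeasurable_id).indepFun hij
  have hmap := (indepFun_iff_map_prod_eq_prod_map_map (measurable_pi_apply i).aemeasurable
    (measurable_pi_apply j).aemeasurable).1 hind
  have hi : (Measure.pi μ).map (fun ω => ω i) = μ i := (measurePreserving_eval μ i).map_eq
  have hj : (Measure.pi μ).map (fun ω => ω j) = μ j := (measurePreserving_eval μ j).map_eq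
  rw [hi, hj] at hmap
  have := ae_prod_ne (μ i) (μ j) hf hg h
  rw [← hmap] at this
  exact ae_of_ae_map (f := fun ω : Fin n → α => (ω i, ω j)) (by fun_prop) this

/-- The laws `F j` may have atoms, but the `2 * n` independent uniform labels are almost surely
distinct. -/
theorem ae_distinct (F : Fin n → Measure ℝ≥0) [∀ j, IsProbabilityMeasure (F j)] :
    ∀ᵐ ω ∂configLaw F, Function.Injective (valueKey ω) ∧ Function.Injective (sampleKey ω) ∧
      ∀ i j, valueKey ω i ≠ sampleKey ω j := by
  have hv : ∀ j c, (((F j).prod volume).prod ((F j).prod volume) :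
      Measure ((ℝ≥0 × unitInterval) × (ℝ≥0 × unitInterval))) {y | y.1.2 = c} = 0 := by
    intro j c
    have : {y : (ℝ≥0 × unitInterval) × (ℝ≥0 × unitInterval) | y.1.2 = c}
        = {y | y.2 = c} ×ˢ Set.univ := by ext; simp
    rw [this, Measure.prod_prod, prod_volume_label_eq, zero_mul]
  have hs : ∀ j c, (((F j).prod volume).prod ((F j).prod volume) :
      Measure ((ℝ≥0 × unitInterval) × (ℝ≥0 × unitInterval))) {y | y.2.2 = c} = 0 := by
    intro j c
    have : {y : (ℝ≥0 × unitInterval) × (ℝ≥0 × unitInterval) | y.2.2 = c}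
        = Set.univ ×ˢ {y | y.2 = c} := by ext; simp
    rw [this, Measure.prod_prod, prod_volume_label_eq, mul_zero]
  have h1 : ∀ᵐ ω ∂configLaw F, ∀ i j, i ≠ j → (ω i).1.2 ≠ (ω j).1.2 := by
    simp only [ae_all_iff]
    exact fun i j hij => ae_pi_ne
      (fun j => ((F j).prod volume).prod ((F j).prod volume)) (f := fun y => y.1.2) (g := fun y => y.1.2)
      (by fun_prop) (by fun_prop) hij (hv j)
  have h2 : ∀ᵐ ω ∂configLaw F, ∀ i j, i ≠ j → (ω i).2.2 ≠ (ω j).2.2 := by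
    simp only [ae_all_iff]
    exact fun i j hij => ae_pi_ne
      (fun j => ((F j).prod volume).prod ((F j).prod volume)) (f := fun y => y.2.2) (g := fun y => y.2.2)
      (by fun_prop) (by fun_prop) hij (hs j)
  have h3 : ∀ᵐ ω ∂configLaw F, ∀ i j, i ≠ j → (ω i).1.2 ≠ (ω j).2.2 := by
    simp only [ae_all_iff]
    exact fun i j hij => ae_pi_ne
      (fun j => ((F j).prod volume).prod ((F j).prod volume)) (f := fun y => y.1.2) (g := fun y => y.2.2)
      (by fun_prop) (by fun_prop) hij (hs j)
  have h4 : ∀ᵐ ω ∂configLaw F, ∀ i, (ω i).1.2 ≠ (ω i).2.2 := by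
    simp only [ae_all_iff]
    intro i
    have := ae_prod_ne ((F i).prod volume) ((F i).prod volume) (f := Prod.snd)
      (g := (Prod.snd : ℝ≥0 × unitInterval → unitInterval)) measurable_snd measurable_snd
      (prod_volume_label_eq (F i))
    exact (measurePreserving_eval (fun j => ((F j).prod volume).prod ((F j).prod volume))
      i).quasiMeasurePreserving.ae this
  filter_upwards [h1, h2, h3, h4] with ω h1 h2 h3 h4
  refine ⟨fun i j h => ?_, fun i j h => ?_, fun i j h => ?_⟩
  · by_contra hne
    exact h1 i j hne (congrArg (fun p => (ofLex p).2) h)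
  · by_contra hne
    exact h2 i j hne (congrArg (fun p => (ofLex p).2) h)
  · have h' : (ω i).1.2 = (ω j).2.2 := congrArg (fun p => (ofLex p).2) h
    by_cases hij : i = j
    · subst hij; exact h4 i h'
    · exact h3 i j hij h'

theorem measurable_card_filter {α ι : Type*} [MeasurableSpace α] [Fintype ι]
    (p : α → ι → Prop) [∀ a, DecidablePred (p a)] (hp : ∀ j, MeasurableSet {a | p a j}) :
    Measurable fun a => (Finset.univ.filter (p a)).card := by
  simp only [Finset.card_filter]
  exact Finset.measurable_sum _ fun j _ => Measurable.ite (hp j) measurable_const measurable_const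

theorem measurableSet_toLex_lt {α : Type*} [MeasurableSpace α] {f g : α → ℝ≥0 × unitInterval}
    (hf : Measurable f) (hg : Measurable g) : MeasurableSet {a | toLex (f a) < toLex (g a)} := by
  simp only [Prod.Lex.toLex_lt_toLex, Set.ofPred_or, Set.ofPred_and]
  exact (measurableSet_lt hf.fst hg.fst).union
    ((measurableSet_eq_fun hf.fst hg.fst).inter (measurableSet_lt hf.snd hg.snd))

theorem measurableSet_candidates (k i : ℕ) (j j' : Fin n) :
    MeasurableSet {ω : Config n |
      j' ∈ candidates k i (valueKey ω) (sampleKey ω) j} := by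
  simp only [mem_candidates, Set.ofPred_and]
  exact (MeasurableSet.const _).inter (measurableSet_toLex_lt (by fun_prop) (by fun_prop))

theorem measurable_guarantee (k i : ℕ) (j : Fin n) :
    Measurable fun ω : Config n => guarantee k i ω j := by
  refine measurable_of_Ioi fun t => ?_
  have hset : (fun ω : Config n => guarantee k i ω j) ⁻¹' Set.Ioi t
      = {ω | decRank (sampleKey ω) j = i + 1} ∩
        ({ω | ∀ j', j' ∈ candidates k i (valueKey ω) (sampleKey ω) j → t < (ω j').1.1} ∩
        {ω | k < (candidates k i (valueKey ω) (sampleKey ω) j).card}) := by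
    ext ω
    exact lt_guarantee_iff
  rw [hset]
  refine MeasurableSet.inter ?_ (MeasurableSet.inter ?_ ?_)
  · have : Measurable fun ω : Config n => decRank (sampleKey ω) j := by
      refine measurable_card_filter (fun ω j' => sampleKey ω j ≤ sampleKey ω j') fun j' => ?_
      simp only [← not_lt]
      exact (measurableSet_toLex_lt (by fun_prop) (by fun_prop)).compl
    exact this (measurableSet_singleton _)
  · simp only [Set.ofPred_forall]
    refine MeasurableSet.iInter fun j' => ?_
    simp only [imp_iff_not_or, Set.ofPred_or]
    exact (measurableSet_candidates k i j j').compl.union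
      (measurableSet_lt measurable_const (by fun_prop))
  · refine measurableSet_lt measurable_const ?_
    have := measurable_card_filter
      (fun ω j' => j' ∈ candidates k i (valueKey ω) (sampleKey ω) j)
      (measurableSet_candidates (n := n) k i j)
    simpa only [Finset.filter_univ_mem] using this

/-- The multiplicity of the rule number `i + 1` in the randomized algorithm. -/
noncomputable def multiplicity (k i : ℕ) : ℝ≥0∞ := if i < k then 1 else 2

/-- Summing over the threshold index `j` loses nothing in the single-swap cases: the event `E i j`
records `j`, so it can be pulled back by the swap at that same `j`. -/
theorem measure_lt_card_le (F : Fin n → Measure ℝ≥0) [∀ j, IsProbabilityMeasure (F j)]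
    (k : ℕ) (t : ℝ≥0) :
    configLaw F {ω | k < (Finset.univ.filter fun j => t < (ω j).1.1).card}
      ≤ ∑ i ∈ Finset.range (k + 1), ∑ j, multiplicity k i *
        configLaw F {ω | t < guarantee k i ω j} := by
  classical
  set ρ := configLaw F with hρ
  set E : ℕ → Fin n → Set (Config n) := fun i j => {ω | t < guarantee k i ω j} with hE
  have hEm : ∀ i j, MeasurableSet (E i j) := fun i j =>
    measurableSet_lt measurable_const (measurable_guarantee k i j)
  set T : Set (Config n) := {ω | k < (Finset.univ.filter fun j => t < (ω j).2.1).card} with hT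
  have hTm : MeasurableSet T := by
    refine measurableSet_lt measurable_const (measurable_card_filter _ fun j => ?_)
    exact measurableSet_lt measurable_const (by fun_prop)
  have hcover : ∀ᵐ ω ∂ρ,
      ω ∈ {ω : Config n | k < (Finset.univ.filter fun j => t < (ω j).1.1).card} → ω ∈ (⋃ j, E k j) ∪ ((⋃ j, swapAll ⁻¹' (E k j ∩ T)) ∪
        ((⋃ j, swapAt j ⁻¹' (E k j \ T)) ∪
          ⋃ i ∈ Finset.range k, ⋃ j, swapAt j ⁻¹' E i j) : Set (Config n)) := by
    filter_upwards [ae_distinct F] with ω ⟨hv, hs, hvs⟩ hω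
    rcases exists_succeeds (isUpperSet_keysAbove t) hv hs hvs hω with
      ⟨j, h⟩ | ⟨j, h⟩ | ⟨j, h, hle⟩ | ⟨i, hi, j, h⟩
    · exact Or.inl (Set.mem_iUnion.2 ⟨j, lt_guarantee_iff.2 h⟩)
    · exact Or.inr (Or.inl (Set.mem_iUnion.2 ⟨j, lt_guarantee_iff.2 h, hω⟩))
    · rw [← valueKey_swapAt, ← sampleKey_swapAt] at h
      rw [← sampleKey_swapAt] at hle
      exact Or.inr (Or.inr (Or.inl (Set.mem_iUnion.2
        ⟨j, lt_guarantee_iff.2 h, fun hT' => absurd hT' hle.not_gt⟩)))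
    · rw [← valueKey_swapAt, ← sampleKey_swapAt] at h
      exact Or.inr (Or.inr (Or.inr (Set.mem_iUnion₂.2
        ⟨i, Finset.mem_range.2 hi, Set.mem_iUnion.2 ⟨j, lt_guarantee_iff.2 h⟩⟩)))
  have hAll : ∀ j, ρ (swapAll ⁻¹' (E k j ∩ T)) = ρ (E k j ∩ T) := fun j =>
    (measurePreserving_swapAll F).measure_preimage ((hEm k j).inter hTm).nullMeasurableSet
  have hAt : ∀ j {S : Set (Config n)}, MeasurableSet S → ρ (swapAt j ⁻¹' S) = ρ S := fun j _ hS =>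
    (measurePreserving_swapAt F j).measure_preimage hS.nullMeasurableSet
  calc ρ {ω | k < (Finset.univ.filter fun j => t < (ω j).1.1).card}
      ≤ _ := measure_mono_ae hcover
    _ ≤ ∑ j, ρ (E k j) + (∑ j, ρ (E k j ∩ T) + (∑ j, ρ (E k j \ T) +
          ∑ i ∈ Finset.range k, ∑ j, ρ (E i j))) := by
        refine (measure_union_le _ _).trans (add_le_add (measure_iUnion_fintype_le _ _) ?_)
        refine (measure_union_le _ _).trans (add_le_add ?_ ?_)
        · exact (measure_iUnion_fintype_le _ _).trans_eq (Finset.sum_congr rfl fun j _ => hAll j)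
        refine (measure_union_le _ _).trans (add_le_add ?_ ?_)
        · exact (measure_iUnion_fintype_le _ _).trans_eq
            (Finset.sum_congr rfl fun j _ => hAt j ((hEm k j).diff hTm))
        · refine (measure_biUnion_finset_le _ _).trans (Finset.sum_le_sum fun i _ => ?_)
          exact (measure_iUnion_fintype_le _ _).trans_eq
            (Finset.sum_congr rfl fun j _ => hAt j (hEm i j))
    _ = ∑ i ∈ Finset.range (k + 1), ∑ j, multiplicity k i * ρ (E i j) := by
        -- The parts of `E k j` inside and outside `T` recombine, leaving rule `k + 1` with two
        -- charges instead of three.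
        rw [Finset.sum_range_succ, ← add_assoc (∑ j, ρ (E k j ∩ T)), ← Finset.sum_add_distrib]
        simp only [measure_inter_add_sdiff _ hTm]
        rw [← add_assoc, add_comm]
        congr 1
        · refine Finset.sum_congr rfl fun i hi => Finset.sum_congr rfl fun j _ => ?_
          rw [multiplicity, if_pos (Finset.mem_range.1 hi), one_mul]
        · simp only [multiplicity, lt_irrefl, if_false]
          rw [← Finset.mul_sum, two_mul]

theorem lintegral_coe_eq_lintegral_meas_lt {α : Type*} [MeasurableSpace α] (μ : Measure α)
    {f : α → ℝ≥0} (hf : Measurable f) :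
    ∫⁻ a, (f a : ℝ≥0∞) ∂μ = ∫⁻ t in Set.Ioi (0 : ℝ), μ {a | t.toNNReal < f a} := by
  have h := lintegral_eq_lintegral_meas_lt μ (f := fun a => (f a : ℝ))
    (Filter.Eventually.of_forall fun a => (f a).coe_nonneg) (by fun_prop)
  simp only [ENNReal.ofReal_coe_nnreal] at h
  rw [h]
  refine setLIntegral_congr_fun measurableSet_Ioi fun t ht => ?_
  simp only [Real.toNNReal_lt_iff_lt_coe (le_of_lt (Set.mem_Ioi.1 ht))]

theorem measurableSet_lt_card_filter (k : ℕ) (t : ℝ≥0) : MeasurableSet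
    {x : Fin n → ℝ≥0 | k < (Finset.univ.filter fun j => t < x j).card} :=
  measurableSet_lt measurable_const (measurable_card_filter _ fun j =>
    measurableSet_lt measurable_const (by fun_prop))

theorem measurable_kthLargest {k : ℕ} (hk : k < n) :
    Measurable fun x : Fin n → ℝ≥0 => kthLargest x ⟨k, hk⟩ := by
  refine measurable_of_Ioi fun t => ?_
  simpa only [Set.preimage, Set.mem_Ioi, lt_kthLargest_iff] using measurableSet_lt_card_filter k t

/-- Layer-cake integration of `measure_lt_card_le` over all levels; it needs no finiteness of the
expectations. -/
theorem lintegral_kthLargest_le (F : Fin n → Measure ℝ≥0) [∀ j, IsProbabilityMeasure (F j)]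
    {k : ℕ} (hk : k < n) :
    ∫⁻ x, (kthLargest x ⟨k, hk⟩ : ℝ≥0∞) ∂Measure.pi F
      ≤ ∑ i ∈ Finset.range (k + 1), ∑ j, multiplicity k i *
        ∫⁻ ω, (guarantee k i ω j : ℝ≥0∞) ∂configLaw F := by
  have hproj : MeasurePreserving (fun (ω : Config n) j => (ω j).1.1) (configLaw F)
      (Measure.pi F) :=
    measurePreserving_pi _ _ fun j => measurePreserving_fst.comp measurePreserving_fst
  have hanti : ∀ i j, Measurable fun t : ℝ =>
      configLaw F {ω | t.toNNReal < guarantee k i ω j} := fun i j => by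
    refine Antitone.measurable fun t t' htt' => measure_mono fun ω hω => ?_
    exact (Real.toNNReal_le_toNNReal htt').trans_lt hω
  calc ∫⁻ x, (kthLargest x ⟨k, hk⟩ : ℝ≥0∞) ∂Measure.pi F
      = ∫⁻ t in Set.Ioi (0 : ℝ),
          Measure.pi F {x | t.toNNReal < kthLargest x ⟨k, hk⟩} :=
        lintegral_coe_eq_lintegral_meas_lt _ (measurable_kthLargest hk)
    _ ≤ ∫⁻ t in Set.Ioi (0 : ℝ), ∑ i ∈ Finset.range (k + 1), ∑ j, multiplicity k i *
          configLaw F {ω | t.toNNReal < guarantee k i ω j} := by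
        refine lintegral_mono fun t => ?_
        simp only [lt_kthLargest_iff]
        rw [← hproj.measure_preimage (measurableSet_lt_card_filter k _).nullMeasurableSet]
        exact measure_lt_card_le F k _
    _ = _ := by
        rw [lintegral_finsetSum _ fun i _ => Finset.measurable_sum _ fun j _ =>
          (hanti i j).const_mul _]
        refine Finset.sum_congr rfl fun i _ => ?_
        rw [lintegral_finsetSum _ fun j _ => (hanti i j).const_mul _]
        refine Finset.sum_congr rfl fun j _ => ?_
        rw [lintegral_const_mul _ (hanti i j),
          lintegral_coe_eq_lintegral_meas_lt _ (measurable_guarantee k i j)]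

theorem measurePreserving_config (F : Fin n → Measure ℝ≥0) [∀ j, IsProbabilityMeasure (F j)] :
    MeasurePreserving
      (fun p : ((Fin n → ℝ≥0) × (Fin n → unitInterval)) ×
        ((Fin n → ℝ≥0) × (Fin n → unitInterval)) => config p.1.1 p.2.1 (p.1.2, p.2.2))
      (((Measure.pi F).prod (labelLaw n)).prod ((Measure.pi F).prod (labelLaw n)))
      (configLaw F) := by
  have h2 := (measurePreserving_arrowProdEquivProdArrow ℝ≥0 unitInterval (Fin n) F
    fun _ => volume).symm
  have h1 := (measurePreserving_arrowProdEquivProdArrow (ℝ≥0 × unitInterval)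
    (ℝ≥0 × unitInterval) (Fin n) (fun j => (F j).prod volume) fun j => (F j).prod volume).symm
  exact h1.comp (h2.prod h2)

theorem measurePreserving_prod_left_comm {α β γ : Type*} [MeasurableSpace α] [MeasurableSpace β]
    [MeasurableSpace γ] (μa : Measure α) (μb : Measure β) (μc : Measure γ) [SFinite μa]
    [SFinite μb] [SFinite μc] :
    MeasurePreserving (fun p : α × β × γ => (p.2.1, (p.1, p.2.2)))
      (μa.prod (μb.prod μc)) (μb.prod (μa.prod μc)) :=
  (measurePreserving_prodAssoc μb μa μc).comp
    ((Measure.measurePreserving_swap.prod (MeasurePreserving.id μc)).comp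
      (measurePreserving_prodAssoc μa μb μc).symm)

theorem measurePreserving_rearrange {α β γ δ ε : Type*} [MeasurableSpace α] [MeasurableSpace β]
    [MeasurableSpace γ] [MeasurableSpace δ] [MeasurableSpace ε] (μa : Measure α) (μb : Measure β)
    (μc : Measure γ) (μd : Measure δ) (μe : Measure ε) [SFinite μa] [SFinite μb] [SFinite μc]
    [SFinite μd] [SFinite μe] :
    MeasurePreserving (fun p : α × β × γ × δ × ε =>
        (p.2.2.1, ((p.1, p.2.2.2.1), (p.2.1, p.2.2.2.2))))
      (μa.prod (μb.prod (μc.prod (μd.prod μe))))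
      (μc.prod ((μa.prod μd).prod (μb.prod μe))) := by
  have h1 := measurePreserving_prod_left_comm μb μc (μd.prod μe)
  have h2 := (MeasurePreserving.id μc).prod (measurePreserving_prod_left_comm μb μd μe)
  have h3 := (MeasurePreserving.id μa).prod (h2.comp h1)
  have h4 := (measurePreserving_prod_left_comm μa μc (μd.prod (μb.prod μe))).comp h3
  exact ((MeasurePreserving.id μc).prod
    (measurePreserving_prodAssoc μa μd (μb.prod μe)).symm).comp h4

theorem lintegral_choiceLaw_prod {α : Type*} [MeasurableSpace α] (μ : Measure α) [SFinite μ]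
    (k : ℕ) {f : Fin (k + 1) × α → ℝ≥0∞} (hf : Measurable f) :
    ∫⁻ p, f p ∂(choiceLaw k).prod μ
      = (1 / ((k : ℝ≥0∞) + 2)) * ∑ i : Fin (k + 1), multiplicity k i * ∫⁻ a, f (i, a) ∂μ := by
  rw [lintegral_prod _ hf.aemeasurable, choiceLaw, lintegral_finsetSum_measure, Finset.mul_sum]
  refine Finset.sum_congr rfl fun i _ => ?_
  rw [lintegral_smul_measure, lintegral_dirac, smul_eq_mul, multiplicity]
  split_ifs
  · rw [one_mul]
  · rw [← mul_assoc, ENNReal.div_eq_inv_mul, ENNReal.div_eq_inv_mul, mul_one]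

/-- Nature's labels are projected away, since the guarantee holds for every removal; the remaining
independent sources are regrouped index by index. -/
theorem measurePreserving_choice_config {k : ℕ} {Ω : Type*} [MeasurableSpace Ω] {P : Measure Ω}
    [IsProbabilityMeasure P] {X : Fin n → Ω → ℝ≥0} (hX : ∀ i, Measurable (X i))
    (hind : iIndepFun X P) :
    MeasurePreserving
      (fun ω : Ω × (Fin n → unitInterval) × (Fin n → ℝ≥0) × (Fin (k + 1) × TieLabels n) =>
        (ω.2.2.2.1, config (fun i => X i ω.1) ω.2.2.1 ω.2.2.2.2))
      (P.prod ((labelLaw n).prod ((Measure.pi fun j => P.map (X j)).prod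
        ((choiceLaw k).prod ((labelLaw n).prod (labelLaw n))))))
      ((choiceLaw k).prod (configLaw fun j => P.map (X j))) := by
  have : ∀ j, IsProbabilityMeasure (P.map (X j)) := fun j =>
    Measure.isProbabilityMeasure_map (hX j).aemeasurable
  have hXP : MeasurePreserving (fun ω i => X i ω) P (Measure.pi fun j => P.map (X j)) :=
    ⟨by fun_prop, (iIndepFun_iff_map_fun_eq_pi_map fun i => (hX i).aemeasurable).1 hind⟩
  have h1 := hXP.prod (measurePreserving_snd (μ := labelLaw n)
    (ν := (Measure.pi fun j => P.map (X j)).prod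
      ((choiceLaw k).prod ((labelLaw n).prod (labelLaw n)))))
  have h2 := measurePreserving_rearrange (Measure.pi fun j => P.map (X j))
    (Measure.pi fun j => P.map (X j)) (choiceLaw k) (labelLaw n) (labelLaw n)
  exact ((MeasurePreserving.id _).prod (measurePreserving_config _)).comp (h2.comp h1)

end Probability

end RPI

/-! ### Assembly of the competitive ratio -/

theorem theorem1 (k : ℕ) :
    RPI.HasCompetitiveRatio.{u} k (RPI.msaRand k) (1 / ((k : NNReal) + 2)) := by
  intro n hn Ω _ P _ X hX hind σ
  have hF : ∀ j, IsProbabilityMeasure (P.map (X j)) := fun j =>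
    Measure.isProbabilityMeasure_map (hX j).aemeasurable
  have hΦ := RPI.measurePreserving_choice_config (k := k) hX hind
  have hg : Measurable fun p : Fin (k + 1) × RPI.Config n =>
      ∑ j, (RPI.guarantee k p.1 p.2 j : ℝ≥0∞) := by
    refine measurable_from_prod_countable_right fun i => ?_
    exact Finset.measurable_sum _ fun j _ => (RPI.measurable_guarantee k i j).coe_nnreal_ennreal
  have hmap : ∫⁻ ω, (RPI.kthLargest (fun i => X i ω) ⟨k, hn⟩ : ℝ≥0∞) ∂P
      ≤ ∫⁻ x, (RPI.kthLargest x ⟨k, hn⟩ : ℝ≥0∞) ∂Measure.pi fun j => P.map (X j) := by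
    rw [← (iIndepFun_iff_map_fun_eq_pi_map fun i => (hX i).aemeasurable).1 hind]
    rw [lintegral_map (RPI.measurable_kthLargest hn).coe_nnreal_ennreal (by fun_prop)]
  have hreward : ∫⁻ p, ∑ j, (RPI.guarantee k p.1 p.2 j : ℝ≥0∞)
        ∂(RPI.choiceLaw k).prod (RPI.configLaw fun j => P.map (X j))
      ≤ RPI.expectedReward (RPI.msaRand k n) k σ P X := by
    rw [← hΦ.lintegral_comp hg]
    refine lintegral_mono_ae ?_
    have hae := (measurePreserving_snd.comp hΦ).quasiMeasurePreserving.ae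
      (RPI.ae_distinct fun j => P.map (X j))
    filter_upwards [hae] with ω hω
    rw [← ENNReal.ofNNReal_finsetSum, ENNReal.coe_le_coe]
    exact RPI.sum_guarantee_le_play σ _ _ _ _ _ hω.2.1
  refine le_trans ?_ hreward
  rw [RPI.lintegral_choiceLaw_prod _ k hg]
  have hcoe : ((1 / ((k : ℝ≥0) + 2) : ℝ≥0) : ℝ≥0∞) = 1 / ((k : ℝ≥0∞) + 2) := by
    rw [ENNReal.coe_div (by positivity)]
    simp
  rw [hcoe]
  gcongr
  refine hmap.trans ((RPI.lintegral_kthLargest_le _ hn).trans_eq ?_)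
  rw [Finset.sum_range]
  refine Finset.sum_congr rfl fun i _ => ?_
  rw [lintegral_finsetSum _ fun j _ => (RPI.measurable_guarantee k i j).coe_nnreal_ennreal,
    Finset.mul_sum]
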